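/- **Theorem 1.3.** Let $G$ be the real Heisenberg group of the matrices $\begin{pmatrix}1&a&c\\0&1&b\\0&0&1\end{pmatrix}$ with $a,b,c\in\mathbb R$, let $\Gamma\subset G$ be the subgroup of the matrices with integer entries, let $\mathbb T=\mathbb R/\mathbb Z$, and let $X=\mathbb T\times\Gamma\backslash G$, where $\Gamma\backslash G$ is the space of cosets $\Gamma g$ with the quotient topology. Let $\varphi,\eta,\psi:\mathbb R\to\mathbb R$ be $C^\infty$ functions of period $1$ with $\int_0^1\varphi(t)\,dt=\int_0^1\eta(t)\,dt=0$, let $\alpha$ be an irrational real number, and let $$S_\alpha:X\to X,\qquad S_\alpha(t,\Gamma g)=\left(t+\alpha,\ \Gamma g\begin{pmatrix}1&\varphi(t)&\psi(t)\\0&1&\eta(t)\\0&0&1\end{pmatrix}\right).$$ For a distance function $d:X\times X\to[0,\infty)$, a Borel probability measure $\rho$ on $X$, $n\ge 1$ and $\varepsilon>0$, put $$\bar d_n(x,y)=\frac1n\sum_{j=0}^{n-1}d(S_\alpha^jx,S_\alpha^jy)$$ and let $s_n(d,\rho,\varepsilon)$ be the least $m\in\mathbb N$ such that $$\rho\Big(\bigcup_{j=1}^m\{y\in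 X:\bar d_n(x_j,y)<\varepsilon\}\Big)>1-\varepsilon\quad\text{for some }x_1,\dots,x_m\in X.$$ The measure complexity of $(X,S_\alpha,\rho)$ with respect to $d$ is called sub-polynomial if $$\liminf_{n\to\infty}\frac{s_n(d,\rho,\varepsilon)}{n^\tau}=0\qquad\text{for all }\tau>0\text{ and all }\varepsilon>0 .$$ Then, for every $S_\alpha$-invariant Borel probability measure $\rho$ on $X$, the measure complexity of $(X,S_\alpha,\rho)$ is sub-polynomial. This holds with respect to 1. the distance $d\big((t,\Gamma g),(t',\Gamma g')\big)=\sqrt{\|t-t'\|^2+\big(\inf_{\gamma\in\Gamma}d_G(g,\gamma g')\big)^2}$, where $\|\cdot\|$ is the distance to the nearest integer and $d_G$ is any left-invariant metric on $G$ such that $d_G(g,g')\le\max(|b|,|a|,|c-ab|)$ whenever $g^{-1}g'=\begin{pmatrix}1&a&c\\0&1&b\\0&0&1\end{pmatrix}$; 2. every metric $d$ that induces the topology of $X$. -/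

import Mathlib

open scoped ContDiff

noncomputable section

namespace HeisSkew

/-! ### The Heisenberg group -/

/-- The real Heisenberg group: `⟨a, b, c⟩` stands for the unipotent upper triangular matrix with
rows `(1, a, c)`, `(0, 1, b)`, `(0, 0, 1)`. -/
@[ext] structure Heis where
  a : ℝ
  b : ℝ
  c : ℝ

namespace Heis

/-- The matrix that an element of the Heisenberg group stands for. -/
def toMatrix (g : Heis) : Matrix (Fin 3) (Fin 3) ℝ :=
  !![1, g.a, g.c; 0, 1, g.b; 0, 0, 1]

instance : Mul Heis := ⟨fun g h => ⟨g.a + h.a, g.b + h.b, g.c + h.c + g.a * h.b⟩⟩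
instance : One Heis := ⟨⟨0, 0, 0⟩⟩
instance : Inv Heis := ⟨fun g => ⟨-g.a, -g.b, g.a * g.b - g.c⟩⟩

@[simp] theorem mul_a (g h : Heis) : (g * h).a = g.a + h.a := rfl
@[simp] theorem mul_b (g h : Heis) : (g * h).b = g.b + h.b := rfl
@[simp] theorem mul_c (g h : Heis) : (g * h).c = g.c + h.c + g.a * h.b := rfl
@[simp] theorem one_a : (1 : Heis).a = 0 := rfl
@[simp] theorem one_b : (1 : Heis).b = 0 := rfl
@[simp] theorem one_c : (1 : Heis).c = 0 := rfl
@[simp] theorem inv_a (g : Heis) : (g⁻¹).a = -g.a := rfl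
@[simp] theorem inv_b (g : Heis) : (g⁻¹).b = -g.b := rfl
@[simp] theorem inv_c (g : Heis) : (g⁻¹).c = g.a * g.b - g.c := rfl

instance : Group Heis :=
  Group.ofLeftAxioms
    (fun x y z => by ext <;> simp <;> ring)
    (fun x => by ext <;> simp)
    (fun x => by ext <;> simp)

/-- The multiplication is matrix multiplication. -/
theorem toMatrix_mul (g h : Heis) : (g * h).toMatrix = g.toMatrix * h.toMatrix := by
  ext i j
  fin_cases i <;> fin_cases j <;>
    simp [toMatrix, Matrix.mul_apply, Fin.sum_univ_three] <;> ring

theorem toMatrix_one : (1 : Heis).toMatrix = 1 := by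
  ext i j
  fin_cases i <;> fin_cases j <;> simp [toMatrix]

/-- The topology of `ℝ³` in the matrix entries. -/
instance : TopologicalSpace Heis :=
  TopologicalSpace.induced (fun g : Heis => (g.a, g.b, g.c)) inferInstance

end Heis

/-- The lattice of the elements with integer entries. -/
def Gam : Subgroup Heis where
  carrier := {g | (∃ k : ℤ, g.a = k) ∧ (∃ k : ℤ, g.b = k) ∧ ∃ k : ℤ, g.c = k}
  one_mem' := ⟨⟨0, by simp⟩, ⟨0, by simp⟩, ⟨0, by simp⟩⟩
  mul_mem' := by
    rintro g h ⟨⟨p, hp⟩, ⟨q, hq⟩, ⟨r, hr⟩⟩ ⟨⟨p', hp'⟩, ⟨q', hq'⟩, ⟨r', hr'⟩⟩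
    exact ⟨⟨p + p', by simp [hp, hp']⟩, ⟨q + q', by simp [hq, hq']⟩,
      ⟨r + r' + p * q', by simp [hr, hr', hp, hq']⟩⟩
  inv_mem' := by
    rintro g ⟨⟨p, hp⟩, ⟨q, hq⟩, ⟨r, hr⟩⟩
    exact ⟨⟨-p, by simp [hp]⟩, ⟨-q, by simp [hq]⟩, ⟨p * q - r, by simp [hp, hq, hr]⟩⟩

/-- The Heisenberg nilmanifold: the space of the cosets `Γ g`. -/
def Nil : Type := Quotient (QuotientGroup.rightRel Gam)

namespace Nil

/-- The coset `Γ g`. -/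
def mk (g : Heis) : Nil := Quotient.mk (QuotientGroup.rightRel Gam) g

/-- The quotient topology. -/
instance : TopologicalSpace Nil :=
  inferInstanceAs (TopologicalSpace (Quotient (QuotientGroup.rightRel Gam)))

theorem mk_eq_mk_iff (g h : Heis) : mk g = mk h ↔ h * g⁻¹ ∈ Gam :=
  Quotient.eq.trans QuotientGroup.rightRel_apply

/-- The right translation `Γ g ↦ Γ g h`. -/
def rmul (x : Nil) (h : Heis) : Nil :=
  Quotient.liftOn x (fun g => mk (g * h)) (by
    intro g g' hg
    refine (mk_eq_mk_iff _ _).2 ?_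
    have h1 : g' * g⁻¹ ∈ Gam := QuotientGroup.rightRel_apply.1 hg
    simpa [mul_assoc] using h1)

theorem rmul_mk (g h : Heis) : rmul (mk g) h = mk (g * h) := rfl

/-- The distance of two cosets that a distance `δ` on the group induces: the infimum of
the distances of their elements. -/
def ndist (δ : Heis → Heis → ℝ) (x y : Nil) : ℝ :=
  sInf {r : ℝ | ∃ g h : Heis, mk g = x ∧ mk h = y ∧ r = δ g h}

/-- For a left invariant `δ` one may fix one of the representatives. -/
theorem ndist_mk (δ : Heis → Heis → ℝ) (hδ : ∀ k g h : Heis, δ (k * g) (k * h) = δ g h)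
    (g h : Heis) : ndist δ (mk g) (mk h) = ⨅ γ : Gam, δ g (γ * h) := by
  unfold ndist iInf
  congr 1
  ext r
  constructor
  · rintro ⟨g', h', hg, hh, rfl⟩
    have h1 := (mk_eq_mk_iff _ _).1 hg
    have h2 := (mk_eq_mk_iff _ _).1 hh.symm
    refine ⟨⟨g * g'⁻¹ * (h' * h⁻¹), Gam.mul_mem h1 h2⟩, ?_⟩
    have h3 := hδ (g * g'⁻¹) g' h'
    simpa [mul_assoc] using h3
  · rintro ⟨γ, rfl⟩
    refine ⟨g, γ * h, rfl, ?_, rfl⟩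
    rw [mk_eq_mk_iff]
    simp

end Nil

/-! ### The phase space and the skew product -/

/-- The product of the circle `ℝ/ℤ` and the Heisenberg nilmanifold, with the product topology and
its Borel sets. -/
def Phase : Type := UnitAddCircle × Nil

instance : TopologicalSpace Phase := inferInstanceAs (TopologicalSpace (UnitAddCircle × Nil))
instance : MeasurableSpace Phase := borel Phase
instance : BorelSpace Phase := ⟨rfl⟩

/-- The skew product `(t, Γ g) ↦ (t + α, Γ g M(t))`, where `M(t)` is the matrix with rows
`(1, φ(t), ψ(t))`, `(0, 1, η(t))`, `(0, 0, 1)`. -/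
def skew (α : ℝ) {φ η ψ : ℝ → ℝ} (hφ : Function.Periodic φ 1) (hη : Function.Periodic η 1)
    (hψ : Function.Periodic ψ 1) (p : Phase) : Phase :=
  (p.1 + (α : UnitAddCircle), p.2.rmul ⟨hφ.lift p.1, hη.lift p.1, hψ.lift p.1⟩)

theorem skew_mk (α : ℝ) {φ η ψ : ℝ → ℝ} (hφ : Function.Periodic φ 1)
    (hη : Function.Periodic η 1) (hψ : Function.Periodic ψ 1) (t : ℝ) (g : Heis) :
    skew α hφ hη hψ ((t : UnitAddCircle), Nil.mk g) =
      (((t + α : ℝ) : UnitAddCircle), Nil.mk (g * ⟨φ t, η t, ψ t⟩)) := rfl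

/-- The distance `√(‖t - t'‖² + d(Γ g, Γ g')²)` on the phase space that a distance on the
Heisenberg group induces; `‖t - t'‖` is the distance of `t - t'` to the nearest integer. -/
def pdist (δ : Heis → Heis → ℝ) (p q : Phase) : ℝ :=
  Real.sqrt (‖p.1 - q.1‖ ^ 2 + Nil.ndist δ p.2 q.2 ^ 2)

/-- The maximum of the absolute values of the coordinates `b`, `a`, `c - a b` of an element of the
Heisenberg group. -/
def kap (g : Heis) : ℝ := max |g.b| (max |g.a| |g.c - g.a * g.b|)

/-! ### Measure complexity -/

section Complexity

variable {X : Type*}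

/-- The mean distance along the first `n` points of two orbits. -/
def meanDist (T : X → X) (d : X → X → ℝ) (n : ℕ) (x y : X) : ℝ :=
  (1 / (n : ℝ)) * ∑ j ∈ Finset.range n, d (T^[j] x) (T^[j] y)

/-- The least number of open `ε`-balls for the mean distance whose union has measure greater than
`1 - ε` (and `⊤` if no finite number of balls suffices). -/
def coverNum [MeasurableSpace X] (T : X → X) (d : X → X → ℝ) (ν : MeasureTheory.Measure X) (n : ℕ)
    (ε : ℝ) : ℕ∞ :=
  sInf {k : ℕ∞ | ∃ (m : ℕ) (x : Fin m → X), k = m ∧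
    1 - ε < ν.real (⋃ j, {y | meanDist T d n (x j) y < ε})}

/-- Sub-polynomial measure complexity with respect to the distance `d`. -/
def SubPolynomial [MeasurableSpace X] (T : X → X) (d : X → X → ℝ)
    (ν : MeasureTheory.Measure X) : Prop :=
  ∀ τ : ℝ, 0 < τ → ∀ ε : ℝ, 0 < ε →
    Filter.liminf (fun n : ℕ => ((coverNum T d ν n ε : ℕ∞) : ENNReal) / (n : ENNReal) ^ τ)
      Filter.atTop = 0

/-- The metric induces the given topology. -/
def Induces [t : TopologicalSpace X] (m : MetricSpace X) : Prop :=
  m.toPseudoMetricSpace.toUniformSpace.toTopologicalSpace = t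

end Complexity

end HeisSkew

end

/-! Let `q` be the denominator of a Dirichlet approximation of `α`. The divisors `chr m α - 1` with
`0 < |m| ≤ q / 2` are then at least `1 / q`, so cohomological equations over the rotation can be
solved for trigonometric polynomials of degree up to `q / 2` at the cost of one factor `q`. The
Fourier tails of smooth functions decay faster than any power of `q`. Writing `W = (f, g, h)`, one
first solves for `f` and `g` (`φ` and `η` have mean zero), then for `h` with right-hand side `ψ + f
η`, whose mean `c` remains. Thus `W` conjugates the skew product to the central translation by `c`,
up to an error `q ^ (-B)`; `W` has size and Lipschitz constant at most `q ^ k`, with `k` independent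
of `B` (`exists_approx_conj`). Central factors cancel when two orbits are compared. For `B` large,
orbits starting close in the conjugated coordinates therefore stay close up to time `q ^ b`
(`close_iterate`), and a grid of `q ^ (4 (2 k + 1))` points shadows every orbit
(`exists_shadowing`). Since `b` may be chosen after `k`, the cover number along `n = q ^ b` is
beaten by any `n ^ τ`, uniformly in the measure (`subPolynomial_of_close`). -/

noncomputable section

namespace HeisSkew

/-! ### Characters of the circle -/

section Fourier

open Complex Filter Topology

/-- The character `t ↦ exp (2 π i m t)` of the circle. -/
def chr (m : ℤ) (t : ℝ) : ℂ := exp (I * ((2 * Real.pi * m * t : ℝ) : ℂ))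

theorem norm_chr (m : ℤ) (t : ℝ) : ‖chr m t‖ = 1 := norm_exp_I_mul_ofReal _

theorem chr_zero (t : ℝ) : chr 0 t = 1 := by simp [chr]

theorem chr_add (m : ℤ) (s t : ℝ) : chr m (s + t) = chr m s * chr m t := by
  rw [chr, chr, chr, ← exp_add]
  congr 1
  push_cast
  ring

theorem chr_mul (m k : ℤ) (t : ℝ) : chr m t * chr k t = chr (m + k) t := by
  rw [chr, chr, chr, ← exp_add]
  congr 1
  push_cast
  ring

theorem chr_intCast (m k : ℤ) : chr m k = 1 := by
  rw [chr, Complex.exp_eq_one_iff]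
  exact ⟨m * k, by push_cast; ring⟩

theorem norm_chr_sub_chr_le (m : ℤ) (s t : ℝ) :
    ‖chr m s - chr m t‖ ≤ 2 * Real.pi * |(m : ℝ)| * |s - t| := by
  have h : chr m s - chr m t = chr m t * (chr m (s - t) - 1) := by
    rw [mul_sub, ← chr_add, mul_one]
    congr 2
    ring
  rw [h, norm_mul, norm_chr, one_mul, chr]
  refine Real.norm_exp_I_mul_ofReal_sub_one_le.trans (le_of_eq ?_)
  rw [Real.norm_eq_abs, abs_mul, abs_mul, abs_of_pos Real.two_pi_pos]

theorem hasDerivAt_chr (m : ℤ) (t : ℝ) :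
    HasDerivAt (chr m) (2 * Real.pi * m * I * chr m t) t := by
  have h : HasDerivAt (fun x : ℝ => I * ((2 * Real.pi * m * x : ℝ) : ℂ))
      (I * ((2 * Real.pi * m * 1 : ℝ) : ℂ)) t :=
    (((hasDerivAt_id t).const_mul (2 * Real.pi * m)).ofReal_comp).const_mul I
  convert! h.cexp using 1
  rw [chr]
  push_cast
  ring

theorem continuous_chr (m : ℤ) : Continuous (chr m) := by
  unfold chr
  fun_prop

/-! ### Small divisors -/

/-- `q` bounds the inverses of the small divisors of frequency at most `q / 2`. -/
def IsGood (α : ℝ) (q : ℕ) : Prop :=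
  ∀ m : ℤ, m ≠ 0 → 2 * |m| ≤ q → 1 / (q : ℝ) ≤ ‖chr m α - 1‖

/-- `|exp (2 π i x) - 1| = 2 |sin (π x)|`, and Jordan's inequality bounds the sine from below. -/
theorem norm_chr_sub_one_ge (m k : ℤ) (α : ℝ) (h : |m * α - k| ≤ 1 / 2) :
    4 * |m * α - k| ≤ ‖chr m α - 1‖ := by
  have h1 : chr m α = exp (I * ((2 * Real.pi * (m * α - k) : ℝ) : ℂ)) := by
    rw [chr, Complex.exp_eq_exp_iff_exists_int]
    exact ⟨k, by push_cast; ring⟩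
  rw [h1, norm_exp_I_mul_ofReal_sub_one, norm_mul, Real.norm_eq_abs, Real.norm_eq_abs,
    abs_of_pos (by norm_num : (0 : ℝ) < 2)]
  have hpi := Real.pi_pos
  have h2 : |2 * Real.pi * (m * α - k) / 2| = Real.pi * |m * α - k| := by
    rw [show 2 * Real.pi * (m * α - k) / 2 = Real.pi * (m * α - k) by ring, abs_mul,
      abs_of_pos hpi]
  have h3 := Real.mul_abs_le_abs_sin (x := 2 * Real.pi * (m * α - k) / 2) (by rw [h2]; nlinarith)
  rw [h2] at h3
  have h4 : 2 / Real.pi * (Real.pi * |m * α - k|) = 2 * |m * α - k| := by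
    field_simp
  linarith

/-- As `r` is reduced, `m r` with `0 < |m| < q` lies at distance at least `1 / q` from the integers.
Passing to `m α` costs at most `(q / 2) / q ^ 2`, half of this, and the factor 4 of
`norm_chr_sub_one_ge` more than compensates. -/
theorem isGood_den (α : ℝ) (r : ℚ) (h : |α - r| ≤ 1 / (r.den : ℝ) ^ 2) : IsGood α r.den := by
  intro m hm hmq
  obtain ⟨q, hq⟩ : ∃ q : ℝ, q = r.den := ⟨_, rfl⟩
  rw [← hq] at h ⊢
  have hq0 : 0 < q := by rw [hq]; exact_mod_cast r.pos
  have hmq' : 2 * |(m : ℝ)| ≤ q := by rw [hq]; exact_mod_cast hmq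
  have hm1 : 1 ≤ |(m : ℝ)| := by exact_mod_cast Int.one_le_abs hm
  set k : ℤ := round (m * α)
  have hk : |m * α - k| ≤ 1 / 2 := abs_sub_round _
  have key : 1 / q ≤ |m * (r : ℝ) - k| := by
    have hr : (r : ℝ) = r.num / q := hq ▸ Rat.cast_def r
    have hne : m * r.num - k * r.den ≠ 0 := by
      intro h0
      have hd : (r.den : ℤ) ∣ m * r.num := ⟨k, by linarith⟩
      have hc : IsCoprime (r.den : ℤ) r.num := by
        rw [Int.isCoprime_iff_nat_coprime]
        simpa [Nat.coprime_comm] using r.reduced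
      have hdm := hc.dvd_of_dvd_mul_right hd
      have := Int.le_of_dvd (abs_pos.2 hm) ((dvd_abs _ _).2 hdm)
      have := abs_pos.2 hm
      omega
    have h1 : (1 : ℝ) ≤ |m * (r.num : ℝ) - k * q| := by
      rw [hq]
      exact_mod_cast Int.one_le_abs hne
    rw [hr, show m * ((r.num : ℝ) / q) - k = (m * (r.num : ℝ) - k * q) / q by field_simp,
      abs_div, abs_of_pos hq0]
    gcongr
  have h2 : |m * α - m * (r : ℝ)| ≤ 1 / (2 * q) := by
    rw [← mul_sub, abs_mul]
    calc |(m : ℝ)| * |α - r| ≤ (q / 2) * (1 / q ^ 2) := by gcongr; linarith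
      _ = 1 / (2 * q) := by field_simp
  have h3 : |m * (r : ℝ) - k| ≤ |m * α - k| + |m * α - m * (r : ℝ)| := by
    rw [show m * (r : ℝ) - k = (m * α - k) - (m * α - m * (r : ℝ)) by ring]
    exact abs_sub _ _
  have h4 : 1 / (2 * q) = 1 / q / 2 := by field_simp
  have h5 := norm_chr_sub_one_ge m k α hk
  have : 0 < 1 / q := by positivity
  linarith

/-- Dirichlet's theorem supplies the approximations; their denominators are unbounded because an
irrational number keeps a positive distance from the rationals of bounded denominator. -/
theorem frequently_isGood {α : ℝ} (hα : Irrational α) : ∃ᶠ q in atTop, IsGood α q := by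
  rw [frequently_atTop]
  intro Q
  have h0 := hα.eventually_forall_le_dist_cast_rat_of_den_le Q
  -- The factor 2 makes the comparison with Dirichlet's bound `1 / (n + 1)` strict.
  have h1 : Tendsto (fun n : ℕ => 2 * (1 / ((n : ℝ) + 1))) atTop (𝓝 0) := by
    simpa using tendsto_one_div_add_atTop_nhds_zero_nat.const_mul (2 : ℝ)
  obtain ⟨n, hn, hn1⟩ := ((h1.eventually h0).and (eventually_ge_atTop 1)).exists
  obtain ⟨r, hr, hrn⟩ := Real.exists_rat_abs_sub_le_and_den_le α hn1
  have hd : (0 : ℝ) < r.den := by exact_mod_cast r.pos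
  have hd1 : (1 : ℝ) ≤ r.den := by exact_mod_cast r.pos
  have hn0 : (0 : ℝ) < (n : ℝ) + 1 := by positivity
  refine ⟨r.den, ?_, isGood_den α r (hr.trans ?_)⟩
  · by_contra hlt
    have h2 := hn r (by omega)
    rw [Real.dist_eq] at h2
    have h3 : 1 / (((n : ℝ) + 1) * r.den) ≤ 1 / ((n : ℝ) + 1) := by
      apply one_div_le_one_div_of_le hn0
      nlinarith
    have : 0 < 1 / ((n : ℝ) + 1) := by positivity
    linarith
  · apply one_div_le_one_div_of_le (by positivity)
    have : (r.den : ℝ) ≤ n := by exact_mod_cast hrn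
    nlinarith

/-! ### Trigonometric polynomials and their cohomological equation -/

/-- The trigonometric polynomial of degree `K` with coefficients `a`. -/
def trigPoly (K : ℕ) (a : ℤ → ℂ) (t : ℝ) : ℂ :=
  ∑ m ∈ Finset.Icc (-(K : ℤ)) K, a m * chr m t

theorem norm_trigPoly_le {K : ℕ} {a : ℤ → ℂ} {A : ℝ} (ha : ∀ m, ‖a m‖ ≤ A) (t : ℝ) :
    ‖trigPoly K a t‖ ≤ (2 * K + 1) * A := by
  refine (norm_sum_le_of_le _ fun m _ => ?_).trans (b := ∑ m ∈ Finset.Icc (-(K : ℤ)) K, A) ?_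
  · rw [norm_mul, norm_chr, mul_one]
    exact ha m
  · rw [Finset.sum_const, nsmul_eq_mul, Int.card_Icc]
    apply le_of_eq
    congr 1
    have : ((K : ℤ) + 1 - -(K : ℤ)).toNat = 2 * K + 1 := by omega
    rw [this]
    push_cast
    ring

theorem norm_trigPoly_sub_le {K : ℕ} {a : ℤ → ℂ} {A : ℝ} (ha : ∀ m, ‖a m‖ ≤ A) (s t : ℝ) :
    ‖trigPoly K a s - trigPoly K a t‖ ≤ (2 * K + 1) * (A * (2 * Real.pi * K * |s - t|)) := by
  have hA : 0 ≤ A := (norm_nonneg _).trans (ha 0)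
  rw [trigPoly, trigPoly, ← Finset.sum_sub_distrib]
  refine (norm_sum_le_of_le _ fun m hm => ?_).trans
    (b := ∑ m ∈ Finset.Icc (-(K : ℤ)) K, (A * (2 * Real.pi * K * |s - t|))) ?_
  · rw [← mul_sub, norm_mul]
    have hm' : |(m : ℝ)| ≤ K := by
      rw [Finset.mem_Icc] at hm
      exact_mod_cast abs_le.2 hm
    have := Real.pi_pos
    gcongr
    · exact ha m
    · refine (norm_chr_sub_chr_le m s t).trans ?_
      gcongr
  · rw [Finset.sum_const, nsmul_eq_mul, Int.card_Icc]
    apply le_of_eq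
    congr 1
    have : ((K : ℤ) + 1 - -(K : ℤ)).toNat = 2 * K + 1 := by omega
    rw [this]
    push_cast
    ring

/-- The coefficients are a convolution of at most `2 K + 1` terms. This serves the product `f η` in
the central coordinate. -/
theorem exists_trigPoly_mul (K : ℕ) {a b : ℤ → ℂ} {A B : ℝ} (ha : ∀ m, ‖a m‖ ≤ A)
    (hb : ∀ m, ‖b m‖ ≤ B) :
    ∃ c : ℤ → ℂ, (∀ m, ‖c m‖ ≤ (2 * K + 1) * (A * B)) ∧
      ∀ t, trigPoly K a t * trigPoly K b t = trigPoly (2 * K) c t := by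
  have hA : 0 ≤ A := (norm_nonneg _).trans (ha 0)
  have hB : 0 ≤ B := (norm_nonneg _).trans (hb 0)
  refine ⟨fun k => ∑ m ∈ Finset.Icc (-(K : ℤ)) K,
    if k - m ∈ Finset.Icc (-(K : ℤ)) K then a m * b (k - m) else 0, fun k => ?_, fun t => ?_⟩
  · refine (norm_sum_le_of_le _ fun m hm => ?_).trans
      (b := ∑ m ∈ Finset.Icc (-(K : ℤ)) K, (A * B)) ?_
    · split_ifs
      · rw [norm_mul]
        exact mul_le_mul (ha _) (hb _) (norm_nonneg _) hA
      · rw [norm_zero]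
        positivity
    · rw [Finset.sum_const, nsmul_eq_mul, Int.card_Icc]
      apply le_of_eq
      congr 1
      have : ((K : ℤ) + 1 - -(K : ℤ)).toNat = 2 * K + 1 := by omega
      rw [this]
      push_cast
      ring
  · simp only [trigPoly]
    rw [Finset.sum_mul_sum]
    simp_rw [Finset.sum_mul]
    rw [Finset.sum_comm (s := Finset.Icc (-((2 * K : ℕ) : ℤ)) _)]
    refine Finset.sum_congr rfl fun m hm => ?_
    rw [Finset.mem_Icc] at hm
    have h1 : ∀ k : ℤ, (if k - m ∈ Finset.Icc (-(K : ℤ)) K then a m * b (k - m) else 0) * chr k t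
        = if k - m ∈ Finset.Icc (-(K : ℤ)) K then a m * b (k - m) * chr k t else 0 := by
      intro k
      split_ifs <;> simp
    simp_rw [h1]
    rw [← Finset.sum_filter]
    refine Finset.sum_bij' (fun j _ => m + j) (fun k _ => k - m) ?_ ?_ ?_ ?_ ?_
    · intro j hj
      rw [Finset.mem_Icc] at hj
      rw [Finset.mem_filter, Finset.mem_Icc, Finset.mem_Icc]
      push_cast
      omega
    · intro k hk
      exact (Finset.mem_filter.1 hk).2
    · intro j _
      ring
    · intro k _
      ring
    · intro j _
      rw [← chr_mul, add_sub_cancel_left]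
      ring

theorem trigPoly_add (K : ℕ) (a b : ℤ → ℂ) (t : ℝ) :
    trigPoly K (fun m => a m + b m) t = trigPoly K a t + trigPoly K b t := by
  rw [trigPoly, trigPoly, trigPoly, ← Finset.sum_add_distrib]
  exact Finset.sum_congr rfl fun m _ => by ring

/-- Extension of a trigonometric polynomial to a larger degree. -/
theorem exists_trigPoly_extend {K K' : ℕ} (h : K ≤ K') {a : ℤ → ℂ} {A : ℝ}
    (ha : ∀ m, ‖a m‖ ≤ A) :
    ∃ c : ℤ → ℂ, (∀ m, ‖c m‖ ≤ A) ∧ ∀ t, trigPoly K a t = trigPoly K' c t := by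
  refine ⟨fun m => if m ∈ Finset.Icc (-(K : ℤ)) K then a m else 0, fun m => ?_, fun t => ?_⟩
  · dsimp only
    split_ifs
    · exact ha m
    · rw [norm_zero]
      exact (norm_nonneg _).trans (ha 0)
  · rw [trigPoly, trigPoly]
    have hsub : Finset.Icc (-(K : ℤ)) K ⊆ Finset.Icc (-(K' : ℤ)) K' :=
      Finset.Icc_subset_Icc (by omega) (by omega)
    rw [← Finset.sum_subset hsub]
    · exact Finset.sum_congr rfl fun m hm => by rw [if_pos hm]
    · intro m _ hm
      rw [if_neg hm, zero_mul]

/-- The cohomological equation over the rotation for trigonometric polynomials of small degree. -/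
theorem exists_trigPoly_coboundary {α : ℝ} {q K : ℕ} (hq : IsGood α q) (hK : 2 * K ≤ q)
    (hq0 : 0 < q) {a : ℤ → ℂ} {A : ℝ} (ha : ∀ m, ‖a m‖ ≤ A) :
    ∃ b : ℤ → ℂ, (∀ m, ‖b m‖ ≤ q * A) ∧
      ∀ t, trigPoly K b (t + α) - trigPoly K b t = trigPoly K a t - a 0 := by
  have hA : 0 ≤ A := (norm_nonneg _).trans (ha 0)
  have hq0' : (0 : ℝ) < q := by exact_mod_cast hq0
  have hdiv : ∀ m : ℤ, m ≠ 0 → m ∈ Finset.Icc (-(K : ℤ)) K → 1 / (q : ℝ) ≤ ‖chr m α - 1‖ := by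
    intro m hm hm'
    rw [Finset.mem_Icc] at hm'
    refine hq m hm ?_
    have := abs_le.2 hm'
    omega
  refine ⟨fun m => if m ≠ 0 ∧ m ∈ Finset.Icc (-(K : ℤ)) K then a m / (chr m α - 1) else 0,
    fun m => ?_, fun t => ?_⟩
  · dsimp only
    split_ifs with h
    · have h1 := hdiv m h.1 h.2
      have h2 : 0 < 1 / (q : ℝ) := by positivity
      rw [norm_div, div_le_iff₀ (h2.trans_le h1)]
      calc ‖a m‖ ≤ A := ha m
        _ = q * A * (1 / q) := by field_simp
        _ ≤ _ := by gcongr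
    · rw [norm_zero]
      positivity
  · have h0 : (0 : ℤ) ∈ Finset.Icc (-(K : ℤ)) K := by
      rw [Finset.mem_Icc]
      omega
    have h2 : a 0 = ∑ m ∈ Finset.Icc (-(K : ℤ)) K, if m = 0 then a 0 else 0 := by
      rw [Finset.sum_ite_eq' _ _ _, if_pos h0]
    rw [trigPoly, trigPoly, trigPoly, ← Finset.sum_sub_distrib]
    conv_rhs => rw [h2]
    rw [← Finset.sum_sub_distrib]
    refine Finset.sum_congr rfl fun m hm => ?_
    by_cases hm0 : m = 0
    · subst hm0
      simp [chr_zero]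
    · have h1 := hdiv m hm0 hm
      have h3 : chr m α - 1 ≠ 0 := by
        intro h
        rw [h, norm_zero] at h1
        have : 0 < 1 / (q : ℝ) := by positivity
        linarith
      rw [if_pos ⟨hm0, hm⟩, if_neg hm0, chr_add]
      field_simp
      ring

/-! ### Fourier series of smooth periodic functions -/

/-- The Fourier coefficients of a function of period one. -/
def fcoef (f : ℝ → ℂ) (m : ℤ) : ℂ := ∫ t in (0 : ℝ)..1, chr (-m) t * f t

theorem norm_fcoef_le {f : ℝ → ℂ} {C : ℝ} (h : ∀ t, ‖f t‖ ≤ C) (m : ℤ) : ‖fcoef f m‖ ≤ C := by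
  have := intervalIntegral.norm_integral_le_of_norm_le_const (a := (0 : ℝ)) (b := 1) (C := C)
    (f := fun t => chr (-m) t * f t) fun t _ => by
      rw [norm_mul, norm_chr, one_mul]
      exact h t
  simpa [fcoef] using this

/-- Integration by parts; periodicity cancels the boundary terms. -/
theorem fcoef_deriv {f f' : ℝ → ℂ} (hf : ∀ t, HasDerivAt f (f' t) t) (hf' : Continuous f')
    (hp : Function.Periodic f 1) (m : ℤ) :
    fcoef f' m = 2 * Real.pi * m * I * fcoef f m := by
  have h := intervalIntegral.integral_mul_deriv_eq_deriv_mul (a := (0 : ℝ)) (b := 1)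
    (u := chr (-m)) (v := f) (u' := fun t => 2 * Real.pi * (-m : ℤ) * I * chr (-m) t) (v' := f')
    (fun t _ => hasDerivAt_chr (-m) t) (fun t _ => hf t)
    ((continuous_const.mul (continuous_chr _)).intervalIntegrable _ _)
    (hf'.intervalIntegrable _ _)
  have h0 : f 1 = f 0 := by simpa using hp 0
  have h1 : chr (-m) 1 = 1 := by simpa using chr_intCast (-m) 1
  have h2 : chr (-m) 0 = 1 := by simpa using chr_intCast (-m) 0
  rw [fcoef, h, h0, h1, h2, fcoef, sub_self, zero_sub, ← intervalIntegral.integral_const_mul,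
    ← intervalIntegral.integral_neg]
  congr 1
  ext t
  push_cast
  ring

/-- The Fourier coefficients of a smooth periodic function decay rapidly. -/
theorem exists_norm_fcoef_mul_pow_le (B : ℕ) : ∀ f : ℝ → ℂ, ContDiff ℝ ∞ f →
    Function.Periodic f 1 → ∃ C : ℝ, ∀ m : ℤ, |(m : ℝ)| ^ B * ‖fcoef f m‖ ≤ C := by
  induction B with
  | zero =>
    intro f hf hp
    obtain ⟨C, hC⟩ := isCompact_Icc.exists_bound_of_continuousOn (s := Set.Icc (0 : ℝ) 1)
      hf.continuous.continuousOn
    refine ⟨C, fun m => ?_⟩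
    rw [pow_zero, one_mul]
    refine norm_fcoef_le (fun t => ?_) m
    obtain ⟨s, hs, hst⟩ := hp.exists_mem_Ico₀ one_pos t
    rw [hst]
    exact hC s (Set.Ico_subset_Icc_self hs)
  | succ B ih =>
    intro f hf hp
    have hd := (contDiff_infty_iff_deriv.1 hf).2
    have hp' : Function.Periodic (deriv f) 1 := fun t => by
      rw [← deriv_comp_add_const, show (fun x => f (x + 1)) = f from funext hp]
    obtain ⟨C, hC⟩ := ih (deriv f) hd hp'
    refine ⟨C, fun m => ?_⟩
    have h1 := fcoef_deriv (fun t => ((contDiff_infty_iff_deriv.1 hf).1 t).hasDerivAt)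
      hd.continuous hp m
    have h2 : ‖fcoef (deriv f) m‖ = 2 * Real.pi * |(m : ℝ)| * ‖fcoef f m‖ := by
      rw [h1]
      simp [abs_of_pos Real.pi_pos]
    have h3 := hC m
    rw [h2] at h3
    refine le_trans ?_ h3
    have hpi := Real.pi_gt_three
    have h4 : 0 ≤ |(m : ℝ)| ^ B * |(m : ℝ)| * ‖fcoef f m‖ := by positivity
    rw [pow_succ]
    nlinarith

theorem hasSum_fcoef {f : ℝ → ℂ} (hf : ContDiff ℝ ∞ f) (hp : Function.Periodic f 1) (t : ℝ) :
    HasSum (fun m => fcoef f m * chr m t) (f t) := by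
  have hc : Continuous (hp.lift : UnitAddCircle → ℂ) :=
    continuous_quot_lift _ hf.continuous
  set F : C(UnitAddCircle, ℂ) := ⟨hp.lift, hc⟩
  have h1 : ∀ m, fourierCoeff F m = fcoef f m := by
    intro m
    rw [fourierCoeff_eq_intervalIntegral _ m 0, fcoef]
    simp only [div_one, one_smul, zero_add]
    refine intervalIntegral.integral_congr fun x _ => ?_
    have h2 : F (x : UnitAddCircle) = f x := rfl
    rw [smul_eq_mul, h2, fourier_coe_apply, chr]
    congr 2
    push_cast
    ring
  obtain ⟨C, hC⟩ := exists_norm_fcoef_mul_pow_le 2 f hf hp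
  have hs : Summable (fourierCoeff F) := by
    rw [show fourierCoeff F = fcoef f from funext h1]
    refine Summable.of_norm_bounded_eventually (g := fun m : ℤ => C * (1 / (m : ℝ) ^ 2))
      ((Real.summable_one_div_int_pow.2 one_lt_two).mul_left C) ?_
    filter_upwards [(Set.finite_singleton (0 : ℤ)).compl_mem_cofinite] with m hm
    have hm0 : (m : ℝ) ≠ 0 := by exact_mod_cast hm
    rw [mul_one_div, le_div_iff₀ (by positivity), mul_comm, ← sq_abs]
    exact hC m
  have h3 := has_pointwise_sum_fourier_series_of_summable hs (t : UnitAddCircle)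
  convert! h3 using 1
  ext m
  rw [h1, smul_eq_mul, fourier_coe_apply, chr]
  congr 2
  push_cast
  ring

/-- The Fourier sums of a smooth periodic function converge rapidly. -/
theorem exists_norm_sub_trigPoly_le {f : ℝ → ℂ} (hf : ContDiff ℝ ∞ f)
    (hp : Function.Periodic f 1) (B : ℕ) :
    ∃ C : ℝ, 0 ≤ C ∧ ∀ (K : ℕ) (t : ℝ),
      ‖f t - trigPoly K (fcoef f) t‖ ≤ C / ((K : ℝ) + 1) ^ B := by
  -- Two of the `B + 2` powers pay for the summability of the tail.
  obtain ⟨C, hC⟩ := exists_norm_fcoef_mul_pow_le (B + 2) f hf hp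
  have hC0 : 0 ≤ C := le_trans (by positivity) (hC 0)
  have hs := Real.summable_one_div_int_pow.2 one_lt_two
  refine ⟨C * ∑' m : ℤ, 1 / (m : ℝ) ^ 2, mul_nonneg hC0 (tsum_nonneg fun m => by positivity),
    fun K t => ?_⟩
  set s := Finset.Icc (-(K : ℤ)) K with hsdef
  have h1 : HasSum (fun m => if m ∈ s then fcoef f m * chr m t else 0) (trigPoly K (fcoef f) t) := by
    rw [trigPoly, Finset.sum_congr rfl fun m hm =>
      (if_pos hm : (if m ∈ s then fcoef f m * chr m t else 0) = _).symm]
    exact hasSum_sum_of_ne_finset_zero fun m hm => if_neg hm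
  rw [← ((hasSum_fcoef hf hp t).sub h1).tsum_eq]
  have hK : (0 : ℝ) < ((K : ℝ) + 1) ^ B := by positivity
  refine tsum_of_norm_bounded ((hs.hasSum.mul_left C).div_const _) fun m => ?_
  split_ifs with hm
  · rw [sub_self, norm_zero]
    positivity
  · rw [sub_zero, norm_mul, norm_chr, mul_one]
    have hm1 : (K : ℝ) + 1 ≤ |(m : ℝ)| := by
      have : (K : ℤ) + 1 ≤ |m| := by
        by_contra hlt
        exact hm (Finset.mem_Icc.2 (abs_le.1 (by omega)))
      exact_mod_cast this
    have hm0 : 0 < |(m : ℝ)| := lt_of_lt_of_le (by positivity) hm1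
    rw [mul_one_div, div_div, le_div_iff₀ (by rw [← sq_abs]; positivity), ← sq_abs]
    refine le_trans ?_ (hC m)
    rw [mul_comm, pow_add, mul_comm (|(m : ℝ)| ^ B)]
    gcongr

end Fourier

/-! ### Approximate conjugacy to a central translation -/

section Conjugacy

open Complex Filter Topology

/-- One constant serves as sup bound and Lipschitz constant: `2 K + 1 ≤ 2 q`, and differentiation
costs at most `2 π K ≤ 4 q`. -/
theorem trigPoly_re_bounds {K q : ℕ} (hq : 1 ≤ q) (hK : 2 * K ≤ q) {a : ℤ → ℂ} {A R : ℝ}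
    (ha : ∀ m, ‖a m‖ ≤ A) (hR : 8 * (q : ℝ) ^ 2 * A ≤ R) :
    (∀ t, |(trigPoly K a t).re| ≤ R) ∧
      ∀ s t, |(trigPoly K a s).re - (trigPoly K a t).re| ≤ R * |s - t| := by
  have hA : 0 ≤ A := (norm_nonneg _).trans (ha 0)
  have hq' : (1 : ℝ) ≤ q := by exact_mod_cast hq
  have hK' : 2 * (K : ℝ) ≤ q := by exact_mod_cast hK
  constructor
  · intro t
    refine (abs_re_le_norm _).trans ((norm_trigPoly_le ha t).trans (le_trans ?_ hR))
    gcongr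
    nlinarith
  · intro s t
    rw [← sub_re]
    refine (abs_re_le_norm _).trans ((norm_trigPoly_sub_le ha s t).trans ?_)
    calc (2 * K + 1) * (A * (2 * Real.pi * K * |s - t|))
        = ((2 * K + 1) * (Real.pi * (2 * K))) * A * |s - t| := by ring
      _ ≤ ((2 * q) * (4 * q)) * A * |s - t| := by
          have := Real.pi_lt_four
          have := Real.pi_pos
          gcongr
          linarith
      _ = 8 * (q : ℝ) ^ 2 * A * |s - t| := by ring
      _ ≤ R * |s - t| := by gcongr

/-- Over a rotation with a good denominator `q`, the skew product is conjugate to a central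
translation by a map of polynomial size in `q`, up to an error that decays rapidly in `q`. -/
theorem exists_approx_conj {α : ℝ} {φ η ψ : ℝ → ℝ}
    (hφ : Function.Periodic φ 1) (hη : Function.Periodic η 1) (hψ : Function.Periodic ψ 1)
    (hφs : ContDiff ℝ ∞ φ) (hηs : ContDiff ℝ ∞ η) (hψs : ContDiff ℝ ∞ ψ)
    (hφ0 : ∫ t in (0 : ℝ)..1, φ t = 0) (hη0 : ∫ t in (0 : ℝ)..1, η t = 0) :
    ∃ k : ℕ, ∀ B : ℕ, ∀ᶠ q : ℕ in atTop, IsGood α q → ∃ (f g h : ℝ → ℝ) (c : ℝ),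
      ((∀ t, |f t| ≤ (q : ℝ) ^ k) ∧ ∀ s t, |f s - f t| ≤ (q : ℝ) ^ k * |s - t|) ∧
      ((∀ t, |g t| ≤ (q : ℝ) ^ k) ∧ ∀ s t, |g s - g t| ≤ (q : ℝ) ^ k * |s - t|) ∧
      ((∀ t, |h t| ≤ (q : ℝ) ^ k) ∧ ∀ s t, |h s - h t| ≤ (q : ℝ) ^ k * |s - t|) ∧
      (∀ t, |φ t + f t - f (t + α)| ≤ 1 / (q : ℝ) ^ B) ∧
      (∀ t, |η t + g t - g (t + α)| ≤ 1 / (q : ℝ) ^ B) ∧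
      ∀ t, |ψ t + f t * η t - c + h t - h (t + α)| ≤ 1 / (q : ℝ) ^ B := by
  have per : ∀ {u : ℝ → ℝ}, Function.Periodic u 1 →
      Function.Periodic (fun t => (u t : ℂ)) 1 := fun hu t => by simp only [hu t]
  have smo : ∀ {u : ℝ → ℝ}, ContDiff ℝ ∞ u → ContDiff ℝ ∞ (fun t => (u t : ℂ)) :=
    fun hu => ofRealCLM.contDiff.comp hu
  have mean : ∀ {u : ℝ → ℝ}, ∫ t in (0 : ℝ)..1, u t = 0 → fcoef (fun t => (u t : ℂ)) 0 = 0 := by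
    intro u hu
    simp only [fcoef, neg_zero, chr_zero, one_mul]
    rw [intervalIntegral.integral_ofReal, hu, ofReal_zero]
  obtain ⟨A, hA1, hAφ, hAη, hAψ⟩ : ∃ A : ℝ, 1 ≤ A ∧
      (∀ m, ‖fcoef (fun t => (φ t : ℂ)) m‖ ≤ A) ∧ (∀ m, ‖fcoef (fun t => (η t : ℂ)) m‖ ≤ A) ∧
      ∀ m, ‖fcoef (fun t => (ψ t : ℂ)) m‖ ≤ A := by
    obtain ⟨C1, h1⟩ := exists_norm_fcoef_mul_pow_le 0 _ (smo hφs) (per hφ)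
    obtain ⟨C2, h2⟩ := exists_norm_fcoef_mul_pow_le 0 _ (smo hηs) (per hη)
    obtain ⟨C3, h3⟩ := exists_norm_fcoef_mul_pow_le 0 _ (smo hψs) (per hψ)
    simp only [pow_zero, one_mul] at h1 h2 h3
    have n1 := (norm_nonneg _).trans (h1 0)
    have n2 := (norm_nonneg _).trans (h2 0)
    have n3 := (norm_nonneg _).trans (h3 0)
    exact ⟨1 + C1 + C2 + C3, by linarith, fun m => by linarith [h1 m], fun m => by linarith [h2 m],
      fun m => by linarith [h3 m]⟩
  -- The largest function is `h`: its coefficients are at most `q * (3 q ^ 2 A ^ 2)`, and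
  -- `trigPoly_re_bounds` adds `8 q ^ 2`. The resulting `24 A ^ 2 q ^ 5` is at most `q ^ 6` for
  -- large `q`.
  refine ⟨6, fun B => ?_⟩
  -- Of the three extra powers, two absorb the size `q ^ 2` of `f` in `f η` and one absorbs the
  -- constants.
  obtain ⟨C, hC0, hCφ, hCη, hCψ⟩ : ∃ C : ℝ, 0 ≤ C ∧
      (∀ (K : ℕ) t, ‖(φ t : ℂ) - trigPoly K (fcoef fun t => (φ t : ℂ)) t‖
        ≤ C / ((K : ℝ) + 1) ^ (B + 3)) ∧
      (∀ (K : ℕ) t, ‖(η t : ℂ) - trigPoly K (fcoef fun t => (η t : ℂ)) t‖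
        ≤ C / ((K : ℝ) + 1) ^ (B + 3)) ∧
      (∀ (K : ℕ) t, ‖(ψ t : ℂ) - trigPoly K (fcoef fun t => (ψ t : ℂ)) t‖
        ≤ C / ((K : ℝ) + 1) ^ (B + 3)) := by
    obtain ⟨C1, n1, h1⟩ := exists_norm_sub_trigPoly_le (smo hφs) (per hφ) (B + 3)
    obtain ⟨C2, n2, h2⟩ := exists_norm_sub_trigPoly_le (smo hηs) (per hη) (B + 3)
    obtain ⟨C3, n3, h3⟩ := exists_norm_sub_trigPoly_le (smo hψs) (per hψ) (B + 3)
    refine ⟨C1 + C2 + C3, by linarith, fun K t => (h1 K t).trans ?_,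
      fun K t => (h2 K t).trans ?_, fun K t => (h3 K t).trans ?_⟩ <;> gcongr <;> linarith
  have hev : ∀ R : ℝ, ∀ᶠ q : ℕ in atTop, R ≤ q := fun R =>
    tendsto_natCast_atTop_atTop.eventually (eventually_ge_atTop R)
  filter_upwards [eventually_ge_atTop 1, hev (24 * A ^ 2), hev (3 * A * C * 4 ^ (B + 3))]
    with q hq1 hq2 hq3 hgood
  have hq' : (1 : ℝ) ≤ q := by exact_mod_cast hq1
  have hq0 : (0 : ℝ) < q := by linarith
  -- The product of two polynomials of degree `K` must still have degree at most `q / 2`.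
  set K := q / 4 with hKdef
  have hK4 : 4 * K ≤ q := Nat.mul_div_le q 4
  have hK4' : q ≤ 4 * (K + 1) := by omega
  have hK1 : (q : ℝ) / 4 ≤ (K : ℝ) + 1 := by
    have : (q : ℝ) ≤ 4 * ((K : ℝ) + 1) := by exact_mod_cast hK4'
    linarith
  have hKq : 4 * (K : ℝ) ≤ q := by exact_mod_cast hK4
  have err : C / ((K : ℝ) + 1) ^ (B + 3) ≤ C * 4 ^ (B + 3) / (q : ℝ) ^ (B + 3) := by
    calc C / ((K : ℝ) + 1) ^ (B + 3) ≤ C / ((q : ℝ) / 4) ^ (B + 3) := by gcongr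
      _ = _ := by rw [div_pow, div_div_eq_mul_div]
  have err3 : (3 * (q : ℝ) ^ 2 * A) * (C / ((K : ℝ) + 1) ^ (B + 3)) ≤ 1 / (q : ℝ) ^ B := by
    calc (3 * (q : ℝ) ^ 2 * A) * (C / ((K : ℝ) + 1) ^ (B + 3))
        ≤ (3 * (q : ℝ) ^ 2 * A) * (C * 4 ^ (B + 3) / (q : ℝ) ^ (B + 3)) := by gcongr
      _ = (3 * A * C * 4 ^ (B + 3)) / q * (1 / (q : ℝ) ^ B) := by
          rw [pow_add (q : ℝ) B 3]
          field_simp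
      _ ≤ 1 * (1 / (q : ℝ) ^ B) := by
          gcongr
          rw [div_le_one hq0]
          exact hq3
      _ = _ := one_mul _
  have hbig : 1 ≤ 3 * (q : ℝ) ^ 2 * A := by nlinarith [one_le_pow₀ hq' (n := 2)]
  have herr0 : 0 ≤ C / ((K : ℝ) + 1) ^ (B + 3) := by positivity
  have err1 : C / ((K : ℝ) + 1) ^ (B + 3) ≤ 1 / (q : ℝ) ^ B := by nlinarith
  obtain ⟨b, hb, hbs⟩ := exists_trigPoly_coboundary hgood (K := K) (by omega) hq1 hAφ
  obtain ⟨b', hb', hbs'⟩ := exists_trigPoly_coboundary hgood (K := K) (by omega) hq1 hAη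
  rw [mean hφ0] at hbs
  rw [mean hη0] at hbs'
  -- The central equation is solved for the truncations: `p` belongs to `f η`, `r` to `ψ`, and the
  -- real part of `p 0 + r 0` becomes the translation `c`.
  obtain ⟨p, hp, hps⟩ := exists_trigPoly_mul K hb hAη
  obtain ⟨r, hr, hrs⟩ := exists_trigPoly_extend (K := K) (K' := 2 * K) (by omega) hAψ
  have hA2 : 1 ≤ A * A := by nlinarith
  have hpr : ∀ m, ‖p m + r m‖ ≤ 3 * (q : ℝ) ^ 2 * A ^ 2 := by
    intro m
    refine (norm_add_le _ _).trans ((add_le_add (hp m) (hr m)).trans ?_)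
    have h1 : (2 * (K : ℝ) + 1) * (q * A * A) ≤ (2 * q) * (q * A * A) := by
      gcongr
      linarith
    have h2 : A ≤ (q : ℝ) ^ 2 * A ^ 2 := by nlinarith [one_le_pow₀ hq' (n := 2)]
    nlinarith
  obtain ⟨s, hs, hss⟩ := exists_trigPoly_coboundary hgood (K := 2 * K) (by omega) hq1 hpr
  have hsize : 8 * (q : ℝ) ^ 2 * (q * (3 * (q : ℝ) ^ 2 * A ^ 2)) ≤ (q : ℝ) ^ 6 := by
    calc 8 * (q : ℝ) ^ 2 * (q * (3 * (q : ℝ) ^ 2 * A ^ 2)) = (q : ℝ) ^ 5 * (24 * A ^ 2) := by ring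
      _ ≤ (q : ℝ) ^ 5 * q := by gcongr
      _ = _ := by ring
  have hsize1 : 8 * (q : ℝ) ^ 2 * (q * A) ≤ (q : ℝ) ^ 6 := by
    refine le_trans ?_ hsize
    gcongr
    nlinarith [one_le_pow₀ hq' (n := 2)]
  have re_bound : ∀ z w : ℂ, ∀ E : ℝ, ‖z - w‖ ≤ E → |z.re - w.re| ≤ E := by
    intro z w E h
    rw [← sub_re]
    exact (abs_re_le_norm _).trans h
  refine ⟨fun t => (trigPoly K b t).re, fun t => (trigPoly K b' t).re,
    fun t => (trigPoly (2 * K) s t).re, (p 0 + r 0).re,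
    trigPoly_re_bounds hq1 (by omega) hb hsize1, trigPoly_re_bounds hq1 (by omega) hb' hsize1,
    trigPoly_re_bounds hq1 (by omega) hs hsize, fun t => ?_, fun t => ?_, fun t => ?_⟩
  · have h1 := congrArg re (hbs t)
    simp only [sub_re, sub_zero] at h1
    have h2 := re_bound _ _ _ ((hCφ K t).trans err1)
    rw [ofReal_re] at h2
    convert h2 using 2
    linarith
  · have h1 := congrArg re (hbs' t)
    simp only [sub_re, sub_zero] at h1
    have h2 := re_bound _ _ _ ((hCη K t).trans err1)
    rw [ofReal_re] at h2
    convert h2 using 2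
    linarith
  · have h1 := congrArg re (hss t)
    rw [trigPoly_add, ← hps, ← hrs] at h1
    simp only [sub_re, add_re] at h1
    have h2 := re_bound _ _ _ (hCψ K t)
    -- The cost of replacing `η` by its truncation in the product `f η`.
    have h3 : |(trigPoly K b t * (η t : ℂ)).re -
        (trigPoly K b t * trigPoly K (fcoef fun t => (η t : ℂ)) t).re|
        ≤ (2 * (q : ℝ) ^ 2 * A) * (C / ((K : ℝ) + 1) ^ (B + 3)) := by
      refine re_bound _ _ _ ?_
      rw [← mul_sub, norm_mul]
      refine mul_le_mul ?_ (hCη K t) (norm_nonneg _) (by positivity)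
      refine (norm_trigPoly_le hb t).trans ?_
      calc (2 * (K : ℝ) + 1) * (q * A) ≤ (2 * q) * (q * A) := by
            gcongr
            linarith
        _ = _ := by ring
    rw [re_mul_ofReal] at h3
    rw [ofReal_re] at h2
    have h4 := abs_add_le (ψ t - (trigPoly K (fcoef fun t => (ψ t : ℂ)) t).re)
      ((trigPoly K b t).re * η t -
        (trigPoly K b t * trigPoly K (fcoef fun t => (η t : ℂ)) t).re)
    have h5 : C / ((K : ℝ) + 1) ^ (B + 3)
        + (2 * (q : ℝ) ^ 2 * A) * (C / ((K : ℝ) + 1) ^ (B + 3)) ≤ 1 / (q : ℝ) ^ B := by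
      refine le_trans ?_ err3
      have : 1 ≤ (q : ℝ) ^ 2 * A := by nlinarith [one_le_pow₀ hq' (n := 2)]
      nlinarith
    refine le_trans (le_of_eq ?_) ((h4.trans (add_le_add h2 h3)).trans h5)
    congr 1
    rw [add_re]
    linarith

end Conjugacy

/-! ### Orbits in the conjugated coordinates and shadowing by a grid -/

section Shadowing

open Filter Topology

/-- All entries are at most `r` in absolute value. -/
def Heis.Small (r : ℝ) (g : Heis) : Prop := |g.a| ≤ r ∧ |g.b| ≤ r ∧ |g.c| ≤ r

/-- The point of the phase space with the given lifts. -/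
def Phase.of (t : ℝ) (g : Heis) : Phase := ((t : UnitAddCircle), Nil.mk g)

/-- The points have lifts at distance at most `δ`. -/
def Close (δ : ℝ) (p q : Phase) : Prop :=
  ∃ (t t' : ℝ) (g g' : Heis), p = Phase.of t g ∧
    q = Phase.of t' g' ∧ |t - t'| ≤ δ ∧ kap (g⁻¹ * g') ≤ δ

theorem Close.mono {δ δ' : ℝ} (h : δ ≤ δ') {p q : Phase} (hpq : Close δ p q) : Close δ' p q := by
  obtain ⟨t, t', g, g', hp, hq, ht, hg⟩ := hpq
  exact ⟨t, t', g, g', hp, hq, ht.trans h, hg.trans h⟩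

/-- The product of the cocycle along the first `n` points of an orbit of the rotation. -/
def cocycle (α : ℝ) (M : ℝ → Heis) : ℕ → ℝ → Heis
  | 0, _ => 1
  | n + 1, t => cocycle α M n t * M (t + n * α)

theorem skew_of (α : ℝ) {φ η ψ : ℝ → ℝ} (hφ : Function.Periodic φ 1)
    (hη : Function.Periodic η 1) (hψ : Function.Periodic ψ 1) (t : ℝ) (g : Heis) :
    skew α hφ hη hψ (Phase.of t g) = Phase.of (t + α) (g * ⟨φ t, η t, ψ t⟩) := rfl

theorem skew_iterate_of (α : ℝ) {φ η ψ : ℝ → ℝ} (hφ : Function.Periodic φ 1)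
    (hη : Function.Periodic η 1) (hψ : Function.Periodic ψ 1) (n : ℕ) (t : ℝ) (g : Heis) :
    (skew α hφ hη hψ)^[n] (Phase.of t g) =
      Phase.of (t + n * α) (g * cocycle α (fun s => ⟨φ s, η s, ψ s⟩) n t) := by
  induction n with
  | zero => simp [cocycle]
  | succ n ih =>
    rw [Function.iterate_succ_apply', ih, skew_of, cocycle, mul_assoc]
    congr 1
    push_cast
    ring

/-- With `W = (f, g, h)`, each matrix factors as `W(s)⁻¹ D(s) (0, 0, c) W(s + α)` with the entries
of `D(s)` at most `e (1 + L)`. The product telescopes, the central factors collect, and `P` is the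
product of the `D`s. The square in the bound for `P.c` comes from the products `a b'` in the group
law. -/
theorem cocycle_eq {α : ℝ} {φ η ψ f g h : ℝ → ℝ} {c e L : ℝ} (hg : ∀ t, |g t| ≤ L)
    (h1 : ∀ t, |φ t + f t - f (t + α)| ≤ e) (h2 : ∀ t, |η t + g t - g (t + α)| ≤ e)
    (h3 : ∀ t, |ψ t + f t * η t - c + h t - h (t + α)| ≤ e) (n : ℕ) (t : ℝ) :
    ∃ P : Heis, |P.a| ≤ n * (e * (1 + L)) ∧ |P.b| ≤ n * (e * (1 + L)) ∧
      |P.c| ≤ n * (e * (1 + L)) + (n * (e * (1 + L))) ^ 2 ∧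
      cocycle α (fun s => ⟨φ s, η s, ψ s⟩) n t =
        (⟨f t, g t, h t⟩ : Heis)⁻¹ * P * ⟨0, 0, n * c⟩ *
          ⟨f (t + n * α), g (t + n * α), h (t + n * α)⟩ := by
  have he : 0 ≤ e := (abs_nonneg _).trans (h1 0)
  have hL : 0 ≤ L := (abs_nonneg _).trans (hg 0)
  set E := e * (1 + L) with hE
  have heE : e ≤ E := by nlinarith
  induction n with
  | zero => exact ⟨1, by simp, by simp, by simp, by ext <;> simp [cocycle]⟩
  | succ n ih =>
    obtain ⟨P, ha, hb, hc, hP⟩ := ih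
    set s := t + n * α with hs
    have hs' : t + ((n + 1 : ℕ) : ℝ) * α = s + α := by rw [hs]; push_cast; ring
    have hE0 : 0 ≤ E := he.trans heE
    have d1 := (h1 s).trans heE
    have d2 := (h2 s).trans heE
    have d3 : |(ψ s + f s * η s - c + h s - h (s + α))
        - (φ s + f s - f (s + α)) * g (s + α)| ≤ E := by
      refine (abs_sub _ _).trans ?_
      rw [abs_mul, hE]
      have := mul_le_mul (h1 s) (hg (s + α)) (abs_nonneg _) he
      linarith [h3 s]
    refine ⟨P * ⟨φ s + f s - f (s + α), η s + g s - g (s + α),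
      (ψ s + f s * η s - c + h s - h (s + α)) - (φ s + f s - f (s + α)) * g (s + α)⟩,
      ?_, ?_, ?_, ?_⟩
    · rw [Heis.mul_a]
      refine (abs_add_le _ _).trans ((add_le_add ha d1).trans (le_of_eq ?_))
      push_cast
      ring
    · rw [Heis.mul_b]
      refine (abs_add_le _ _).trans ((add_le_add hb d2).trans (le_of_eq ?_))
      push_cast
      ring
    · rw [Heis.mul_c]
      refine (abs_add_three _ _ _).trans ?_
      rw [abs_mul]
      have := mul_le_mul ha d2 (abs_nonneg _) (by positivity)
      refine (add_le_add (add_le_add hc d3) this).trans ?_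
      push_cast
      nlinarith [mul_nonneg hE0 hE0, mul_nonneg (mul_nonneg (Nat.cast_nonneg (α := ℝ) n) hE0) hE0]
    · rw [cocycle, hP, ← hs, hs']
      ext
      · simp
        ring
      · simp
        ring
      · simp
        ring

/-- The central entry is a sum of seven terms, each an entry or a product of two entries, and `s ≤
1` bounds the products by `s`. -/
theorem small_conj {s : ℝ} (hs : s ≤ 1) {P w Q : Heis} (hP : P.Small s) (hw : w.Small s)
    (hQ : Q.Small s) : (P⁻¹ * w * Q).Small (7 * s) := by
  obtain ⟨p1, p2, p3⟩ := hP
  obtain ⟨w1, w2, w3⟩ := hw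
  obtain ⟨q1, q2, q3⟩ := hQ
  have hs0 : 0 ≤ s := (abs_nonneg _).trans p1
  have m : ∀ x y : ℝ, |x| ≤ s → |y| ≤ s → |x * y| ≤ s := by
    intro x y hx hy
    rw [abs_mul]
    nlinarith [abs_nonneg x, abs_nonneg y]
  have m1 := m _ _ p1 p2
  have m2 := m _ _ p1 w2
  have m3 := m _ _ p1 q2
  have m4 := m _ _ w1 q2
  simp only [Heis.Small, Heis.mul_a, Heis.mul_b, Heis.mul_c, Heis.inv_a, Heis.inv_b, Heis.inv_c,
    add_mul, neg_mul]
  simp only [abs_le] at *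
  refine ⟨⟨?_, ?_⟩, ⟨?_, ?_⟩, ?_, ?_⟩ <;> linarith

/-- The sizes of `V` and `W` enter only as factors of the small quantities `v` and `W - V`, so the
loss is linear in `L`. -/
theorem kap_conj_le {L s d : ℝ} (hL : 1 ≤ L) {V W v : Heis} (hV : V.Small L) (hW : W.Small L)
    (hv : v.Small s) (ha : |W.a - V.a| ≤ d) (hb : |W.b - V.b| ≤ d) (hc : |W.c - V.c| ≤ d)
    (hsd : s + d ≤ 1) : kap (V⁻¹ * v * W) ≤ 4 * L * s + 3 * L * d := by
  obtain ⟨v1, v2, v3⟩ := hv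
  have hs0 : 0 ≤ s := (abs_nonneg _).trans v1
  have hd0 : 0 ≤ d := (abs_nonneg _).trans ha
  have hLs : s ≤ L * s := by nlinarith
  have hLd : d ≤ L * d := by nlinarith
  have e1 : |v.a + (W.a - V.a)| ≤ s + d := (abs_add_le _ _).trans (add_le_add v1 ha)
  have e2 : |v.b + (W.b - V.b)| ≤ s + d := (abs_add_le _ _).trans (add_le_add v2 hb)
  have e3 : |(W.c - V.c) + v.c - V.a * (W.b - V.b) - V.a * v.b + v.a * W.b|
      ≤ d + s + L * d + L * s + s * L := by
    have m1 : |V.a * (W.b - V.b)| ≤ L * d := by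
      rw [abs_mul]
      exact mul_le_mul hV.1 hb (abs_nonneg _) (by linarith)
    have m2 : |V.a * v.b| ≤ L * s := by
      rw [abs_mul]
      exact mul_le_mul hV.1 v2 (abs_nonneg _) (by linarith)
    have m3 : |v.a * W.b| ≤ s * L := by
      rw [abs_mul]
      exact mul_le_mul v1 hW.2.1 (abs_nonneg _) hs0
    rw [abs_le] at *
    constructor <;> linarith
  have e4 : |(v.a + (W.a - V.a)) * (v.b + (W.b - V.b))| ≤ s + d := by
    rw [abs_mul]
    nlinarith [abs_nonneg (v.a + (W.a - V.a)), abs_nonneg (v.b + (W.b - V.b))]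
  have c1 : (V⁻¹ * v * W).a = v.a + (W.a - V.a) := by simp; ring
  have c2 : (V⁻¹ * v * W).b = v.b + (W.b - V.b) := by simp; ring
  have c3 : (V⁻¹ * v * W).c =
      (W.c - V.c) + v.c - V.a * (W.b - V.b) - V.a * v.b + v.a * W.b := by simp; ring
  rw [kap, c1, c2, c3]
  refine max_le (by nlinarith) (max_le (by nlinarith) ((abs_sub _ _).trans ?_))
  nlinarith

/-- Orbits whose initial points are close in the conjugated coordinates stay close. -/
theorem close_iterate {α : ℝ} {φ η ψ f g h : ℝ → ℝ} (hφ : Function.Periodic φ 1)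
    (hη : Function.Periodic η 1) (hψ : Function.Periodic ψ 1) {c e L s : ℝ} (hL : 1 ≤ L)
    (hf : (∀ t, |f t| ≤ L) ∧ ∀ s t, |f s - f t| ≤ L * |s - t|)
    (hg : (∀ t, |g t| ≤ L) ∧ ∀ s t, |g s - g t| ≤ L * |s - t|)
    (hh : (∀ t, |h t| ≤ L) ∧ ∀ s t, |h s - h t| ≤ L * |s - t|)
    (h1 : ∀ t, |φ t + f t - f (t + α)| ≤ e) (h2 : ∀ t, |η t + g t - g (t + α)| ≤ e)
    (h3 : ∀ t, |ψ t + f t * η t - c + h t - h (t + α)| ≤ e) {n : ℕ}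
    (hn : 2 * (n * (e * (1 + L))) ≤ s) (hs : 31 * L ^ 2 * s ≤ 1) {t t' : ℝ} (ht : |t - t'| ≤ s)
    {u u' : Heis} (hu : (u⁻¹ * u').Small s) :
    Close (31 * L ^ 2 * s)
      ((skew α hφ hη hψ)^[n] (Phase.of t (u * ⟨f t, g t, h t⟩)))
      ((skew α hφ hη hψ)^[n] (Phase.of t' (u' * ⟨f t', g t', h t'⟩))) := by
  have hs0 : 0 ≤ s := (abs_nonneg _).trans ht
  have he : 0 ≤ e := (abs_nonneg _).trans (h1 0)
  have hL2 : L ≤ L ^ 2 := by nlinarith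
  have hLs : L * s ≤ L ^ 2 * s := by gcongr
  have hLs1 : s ≤ L * s := by nlinarith
  obtain ⟨P, pa, pb, pc, hP⟩ := cocycle_eq hg.1 h1 h2 h3 n t
  obtain ⟨Q, qa, qb, qc, hQ⟩ := cocycle_eq hg.1 h1 h2 h3 n t'
  have hx0 : 0 ≤ n * (e * (1 + L)) := by positivity
  obtain ⟨x, hx⟩ : ∃ x, x = n * (e * (1 + L)) := ⟨_, rfl⟩
  rw [← hx] at pa pb pc qa qb qc hn hx0
  -- Since `x ≤ 1`, the central entries of `P` and `Q` are at most `x + x ^ 2 ≤ 2 x ≤ s`.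
  have hx2 : x ^ 2 ≤ x := by nlinarith
  have hPs : P.Small s := ⟨by linarith, by linarith, by linarith⟩
  have hQs : Q.Small s := ⟨by linarith, by linarith, by linarith⟩
  have hv := small_conj (by nlinarith) hPs hu hQs
  rw [skew_iterate_of, skew_iterate_of]
  refine ⟨_, _, _, _, rfl, rfl, ?_, ?_⟩
  · rw [add_sub_add_right_eq_sub]
    nlinarith
  · rw [hP, hQ]
    -- Both orbits carry the same central factor, so it cancels whatever its size; this is what
    -- allows long times.
    have hrel : (u * ⟨f t, g t, h t⟩ * ((⟨f t, g t, h t⟩ : Heis)⁻¹ * P * ⟨0, 0, n * c⟩ *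
          ⟨f (t + n * α), g (t + n * α), h (t + n * α)⟩))⁻¹ *
        (u' * ⟨f t', g t', h t'⟩ * ((⟨f t', g t', h t'⟩ : Heis)⁻¹ * Q * ⟨0, 0, n * c⟩ *
          ⟨f (t' + n * α), g (t' + n * α), h (t' + n * α)⟩)) =
        (⟨f (t + n * α), g (t + n * α), h (t + n * α)⟩ : Heis)⁻¹ * (P⁻¹ * (u⁻¹ * u') * Q) *
          ⟨f (t' + n * α), g (t' + n * α), h (t' + n * α)⟩ := by
      have hz : ∀ y : Heis, (⟨0, 0, n * c⟩ : Heis)⁻¹ * y * ⟨0, 0, n * c⟩ = y := by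
        intro y
        ext <;> simp
      rw [← hz (P⁻¹ * (u⁻¹ * u') * Q)]
      group
    rw [hrel]
    have hlip : |(t' + n * α) - (t + n * α)| ≤ s := by
      rw [add_sub_add_right_eq_sub, abs_sub_comm]
      exact ht
    have hmul : L * |(t' + n * α) - (t + n * α)| ≤ L * s := by gcongr
    -- With `7 s` from `small_conj` and `d = L s`, the bound is `28 L s + 3 L ^ 2 s ≤ 31 L ^ 2 s`.
    refine (kap_conj_le hL (V := ⟨f (t + n * α), g (t + n * α), h (t + n * α)⟩)
      (W := ⟨f (t' + n * α), g (t' + n * α), h (t' + n * α)⟩)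
      ⟨hf.1 _, hg.1 _, hh.1 _⟩ ⟨hf.1 _, hg.1 _, hh.1 _⟩ hv
      ((hf.2 _ _).trans hmul) ((hg.2 _ _).trans hmul) ((hh.2 _ _).trans hmul)
      (by linarith)).trans ?_
    nlinarith

/-- The unit cube is a fundamental domain. The third floor is taken after the shift of `c` by
`-⌊g.a⌋ * g.b` that the first entry of `γ` causes. -/
theorem exists_gam_mul_mem (g : Heis) : ∃ γ ∈ Gam, (γ * g).a ∈ Set.Ico (0 : ℝ) 1 ∧
    (γ * g).b ∈ Set.Ico (0 : ℝ) 1 ∧ (γ * g).c ∈ Set.Ico (0 : ℝ) 1 := by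
  refine ⟨⟨(-⌊g.a⌋ : ℤ), (-⌊g.b⌋ : ℤ), (-⌊g.c + (-⌊g.a⌋ : ℤ) * g.b⌋ : ℤ)⟩,
    ⟨⟨_, rfl⟩, ⟨_, rfl⟩, ⟨_, rfl⟩⟩, ?_, ?_, ?_⟩
  · have : ∀ x : ℝ, ((-⌊x⌋ : ℤ) : ℝ) + x = Int.fract x := fun x => by
      rw [Int.fract]; push_cast; ring
    rw [Heis.mul_a, this]
    exact ⟨Int.fract_nonneg _, Int.fract_lt_one _⟩
  · have : ∀ x : ℝ, ((-⌊x⌋ : ℤ) : ℝ) + x = Int.fract x := fun x => by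
      rw [Int.fract]; push_cast; ring
    rw [Heis.mul_b, this]
    exact ⟨Int.fract_nonneg _, Int.fract_lt_one _⟩
  · have : ∀ x y : ℝ, ((-⌊x + y⌋ : ℤ) : ℝ) + x + y = Int.fract (x + y) := fun x y => by
      rw [Int.fract]; push_cast; ring
    rw [Heis.mul_c, this]
    exact ⟨Int.fract_nonneg _, Int.fract_lt_one _⟩

theorem Phase.of_gam_mul {γ : Heis} (hγ : γ ∈ Gam) (t : ℝ) (g : Heis) :
    Phase.of t (γ * g) = Phase.of t g := by
  refine Prod.ext rfl ((Nil.mk_eq_mk_iff _ _).2 ?_)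
  simpa using Gam.inv_mem hγ

theorem Phase.of_sub_intCast (k : ℤ) (t : ℝ) (g : Heis) :
    Phase.of (t - k) g = Phase.of t g := by
  refine Prod.ext ?_ rfl
  refine QuotientAddGroup.eq.2 (AddSubgroup.mem_zmultiples_iff.2 ⟨k, ?_⟩)
  rw [zsmul_eq_mul]
  ring

theorem Phase.exists_eq_of (p : Phase) : ∃ (t : ℝ) (g : Heis), t ∈ Set.Ico (0 : ℝ) 1 ∧
    p = Phase.of t g := by
  obtain ⟨x, y⟩ := p
  obtain ⟨t, rfl⟩ := QuotientAddGroup.mk_surjective x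
  obtain ⟨g, rfl⟩ := Quotient.exists_rep y
  exact ⟨Int.fract t, g, ⟨Int.fract_nonneg _, Int.fract_lt_one _⟩,
    (Phase.of_sub_intCast ⌊t⌋ t g).symm⟩

theorem exists_fin_div_near {N : ℕ} {x : ℝ} (hx : x ∈ Set.Ico (0 : ℝ) 1) (hN : 0 < N) :
    ∃ i : Fin N, |(i : ℝ) / N - x| ≤ 1 / N := by
  have hN' : (0 : ℝ) < N := by exact_mod_cast hN
  have h0 : 0 ≤ x * N := mul_nonneg hx.1 hN'.le
  have h1 := Nat.floor_le h0
  have h2 := Nat.lt_floor_add_one (x * N)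
  refine ⟨⟨⌊x * N⌋₊, ?_⟩, ?_⟩
  · rw [Nat.floor_lt h0]
    nlinarith [hx.2]
  · rw [show ((⌊x * N⌋₊ : ℕ) : ℝ) / N - x = (⌊x * N⌋₊ - x * N) / N by field_simp, abs_div,
      abs_of_pos hN']
    gcongr
    rw [abs_le]
    constructor <;> linarith

/-- The orbits over a grid in the conjugated coordinates shadow all orbits. -/
theorem exists_shadowing {α : ℝ} {φ η ψ f g h : ℝ → ℝ} (hφ : Function.Periodic φ 1)
    (hη : Function.Periodic η 1) (hψ : Function.Periodic ψ 1) {c e L : ℝ} (hL : 1 ≤ L)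
    (hf : (∀ t, |f t| ≤ L) ∧ ∀ s t, |f s - f t| ≤ L * |s - t|)
    (hg : (∀ t, |g t| ≤ L) ∧ ∀ s t, |g s - g t| ≤ L * |s - t|)
    (hh : (∀ t, |h t| ≤ L) ∧ ∀ s t, |h s - h t| ≤ L * |s - t|)
    (h1 : ∀ t, |φ t + f t - f (t + α)| ≤ e) (h2 : ∀ t, |η t + g t - g (t + α)| ≤ e)
    (h3 : ∀ t, |ψ t + f t * η t - c + h t - h (t + α)| ≤ e) {n N : ℕ} (hN : 0 < N)
    (hn : 2 * (n * (e * (1 + L))) ≤ 4 / N) (hs : 31 * L ^ 2 * (4 / N) ≤ 1) :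
    ∃ x : Fin (N ^ 4) → Phase, ∀ y, ∃ i, ∀ j ≤ n, Close (31 * L ^ 2 * (4 / N))
      ((skew α hφ hη hψ)^[j] (x i)) ((skew α hφ hη hψ)^[j] y) := by
  have hN' : (0 : ℝ) < N := by exact_mod_cast hN
  have he : 0 ≤ e := (abs_nonneg _).trans (h1 0)
  have hcard : Fintype.card (Fin 4 → Fin N) = N ^ 4 := by simp
  obtain ⟨E⟩ : Nonempty ((Fin 4 → Fin N) ≃ Fin (N ^ 4)) :=
    ⟨Fintype.equivFinOfCardEq hcard⟩
  let W : ℝ → Heis := fun t => ⟨f t, g t, h t⟩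
  let x : (Fin 4 → Fin N) → Phase := fun i => Phase.of ((i 0 : ℝ) / N)
    ((⟨(i 1 : ℝ) / N, (i 2 : ℝ) / N, (i 3 : ℝ) / N⟩ * W ((i 0 : ℝ) / N)))
  refine ⟨fun i => x (E.symm i), fun y => ?_⟩
  obtain ⟨t, k, ht, rfl⟩ := Phase.exists_eq_of y
  -- The reduction to the unit cube takes place after division by `W t`, since the grid lives in the
  -- conjugated coordinates.
  obtain ⟨γ, hγ, ha, hb, hc⟩ := exists_gam_mul_mem (k * (W t)⁻¹)
  set u := γ * (k * (W t)⁻¹) with hu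
  have hk : Phase.of t k = Phase.of t (u * W t) := by
    rw [hu, mul_assoc, Phase.of_gam_mul hγ, inv_mul_cancel_right]
  obtain ⟨i0, hi0⟩ := exists_fin_div_near ht hN
  obtain ⟨i1, hi1⟩ := exists_fin_div_near ha hN
  obtain ⟨i2, hi2⟩ := exists_fin_div_near hb hN
  obtain ⟨i3, hi3⟩ := exists_fin_div_near hc hN
  refine ⟨E ![i0, i1, i2, i3], fun j hj => ?_⟩
  have h14 : 1 / (N : ℝ) ≤ 4 / N := by gcongr; norm_num
  have h12 : 1 / (N : ℝ) + 1 / N ≤ 4 / N := by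
    rw [← add_div]
    gcongr
    norm_num
  dsimp only
  rw [Equiv.symm_apply_apply, hk]
  refine close_iterate hφ hη hψ hL hf hg hh h1 h2 h3 (le_trans ?_ hn) hs (hi0.trans h14)
    (u := ⟨(i1 : ℝ) / N, (i2 : ℝ) / N, (i3 : ℝ) / N⟩) ?_
  · have : (j : ℝ) ≤ n := by exact_mod_cast hj
    gcongr
  · have hi1' : |(i1 : ℝ) / N| ≤ 1 := by
      rw [abs_of_nonneg (by positivity), div_le_one hN']
      exact_mod_cast i1.2.le
    refine ⟨?_, ?_, ?_⟩
    · refine le_trans (le_of_eq ?_) (hi1.trans h14)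
      rw [abs_sub_comm, Heis.mul_a, Heis.inv_a]
      congr 1
      ring
    · refine le_trans (le_of_eq ?_) (hi2.trans h14)
      rw [abs_sub_comm, Heis.mul_b, Heis.inv_b]
      congr 1
      ring
    -- The central entry of the quotient has an additional term, `i1 / N` times the error in `b`,
    -- hence `2 / N` in place of `1 / N`.
    · refine le_trans ?_ h12
      have h4 : |(i1 : ℝ) / N * ((i2 : ℝ) / N - u.b)| ≤ 1 / N := by
        rw [abs_mul]
        nlinarith [abs_nonneg ((i1 : ℝ) / N), abs_nonneg ((i2 : ℝ) / N - u.b)]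
      rw [abs_sub_comm] at hi3
      refine le_trans (le_of_eq ?_) ((abs_add_le _ _).trans (add_le_add hi3 h4))
      rw [Heis.mul_c, Heis.inv_c, Heis.inv_a]
      congr 1
      ring

end Shadowing

/-! ### Cover numbers -/

section Covering

open Filter Topology

theorem meanDist_le {X : Type*} {T : X → X} {d : X → X → ℝ} {n : ℕ} {x y : X} {r : ℝ}
    (hn : 0 < n) (h : ∀ j < n, d (T^[j] x) (T^[j] y) ≤ r) : meanDist T d n x y ≤ r := by
  have hn' : (0 : ℝ) < n := by exact_mod_cast hn
  have h1 : ∑ j ∈ Finset.range n, d (T^[j] x) (T^[j] y) ≤ n * r := by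
    refine (Finset.sum_le_sum fun j hj => h j (Finset.mem_range.1 hj)).trans (le_of_eq ?_)
    simp
  rw [meanDist, one_div, inv_mul_le_iff₀ hn']
  exact h1

theorem coverNum_le {X : Type*} [MeasurableSpace X] {T : X → X} {d : X → X → ℝ}
    (ν : MeasureTheory.Measure X) [MeasureTheory.IsProbabilityMeasure ν] {n m : ℕ} {ε : ℝ}
    (hε : 0 < ε) (x : Fin m → X) (h : ∀ y, ∃ i, meanDist T d n (x i) y < ε) :
    coverNum T d ν n ε ≤ m := by
  refine sInf_le ⟨m, x, rfl, ?_⟩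
  have hU : (⋃ j, {y | meanDist T d n (x j) y < ε}) = Set.univ :=
    Set.eq_univ_of_forall fun y => Set.mem_iUnion.2 (h y)
  rw [hU, MeasureTheory.probReal_univ]
  linarith

theorem natCast_pow_div_rpow_le {q k b : ℕ} {τ : ℝ} (hq : 0 < q) (h : (k : ℝ) + 1 ≤ b * τ) :
    ((q ^ k : ℕ) : ENNReal) / ((q ^ b : ℕ) : ENNReal) ^ τ ≤ (q : ENNReal)⁻¹ := by
  have hq0 : (q : ENNReal) ≠ 0 := by exact_mod_cast hq.ne'
  have hqt : (q : ENNReal) ≠ ⊤ := ENNReal.natCast_ne_top q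
  have hq1 : (1 : ENNReal) ≤ q := by exact_mod_cast hq
  rw [Nat.cast_pow, Nat.cast_pow, ← ENNReal.rpow_natCast, ← ENNReal.rpow_natCast,
    ← ENNReal.rpow_mul, ← ENNReal.rpow_sub _ _ hq0 hqt, ← ENNReal.rpow_neg_one]
  exact ENNReal.rpow_le_rpow_of_exponent_le hq1 (by linarith)

/-- The only property of `d` that matters is that it is small, uniformly, on pairs with close lifts.
Both kinds of distance are reduced to this. -/
theorem subPolynomial_of_close {α : ℝ} (hα : Irrational α) {φ η ψ : ℝ → ℝ}
    (hφ : Function.Periodic φ 1) (hη : Function.Periodic η 1) (hψ : Function.Periodic ψ 1)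
    (hφs : ContDiff ℝ ∞ φ) (hηs : ContDiff ℝ ∞ η) (hψs : ContDiff ℝ ∞ ψ)
    (hφ0 : ∫ t in (0 : ℝ)..1, φ t = 0) (hη0 : ∫ t in (0 : ℝ)..1, η t = 0)
    (ρ : MeasureTheory.Measure Phase) [MeasureTheory.IsProbabilityMeasure ρ] {d : Phase → Phase → ℝ}
    (hd : ∀ ε : ℝ, 0 < ε → ∃ δ : ℝ, 0 < δ ∧ ∀ p q, Close δ p q → d p q ≤ ε) :
    SubPolynomial (skew α hφ hη hψ) d ρ := by
  intro τ hτ ε hε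
  obtain ⟨δ, hδ, hclose⟩ := hd (ε / 2) (half_pos hε)
  obtain ⟨k, hk⟩ := exists_approx_conj (α := α) hφ hη hψ hφs hηs hψs hφ0 hη0
  -- There will be `q ^ (4 (2 k + 1))` balls at time `q ^ b`; this `b` makes the quotient at most `1
  -- / q`.
  obtain ⟨b, hb⟩ := exists_nat_gt ((((2 * k + 1) * 4 : ℕ) + 1 : ℝ) / τ)
  rw [div_lt_iff₀ hτ] at hb
  have hb0 : b ≠ 0 := by
    rintro rfl
    rw [Nat.cast_zero, zero_mul] at hb
    have : (0 : ℝ) ≤ ((2 * k + 1) * 4 : ℕ) := Nat.cast_nonneg _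
    linarith
  refine le_antisymm (ENNReal.le_of_forall_pos_le_add fun c hc _ => ?_) bot_le
  rw [zero_add]
  refine liminf_le_of_frequently_le' ((tendsto_pow_atTop hb0).frequently ?_)
  have hinv : ∀ᶠ q : ℕ in atTop, (q : ENNReal)⁻¹ ≤ c :=
    (ENNReal.tendsto_inv_nat_nhds_zero.eventually_lt_const (by exact_mod_cast hc)).mono
      fun _ h => h.le
  have hev : ∀ R : ℝ, ∀ᶠ q : ℕ in atTop, R ≤ q := fun R =>
    tendsto_natCast_atTop_atTop.eventually (eventually_ge_atTop R)
  -- The exponent `b + (3 k + 1)` pays for the time `q ^ b`, for the factor `1 + L ≤ 2 q ^ k` and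
  -- for the grid scale `q ^ (-(2 k + 1))`.
  refine ((frequently_isGood hα).and_eventually ((hk (b + (3 * k + 1))).and
    ((eventually_ge_atTop 1).and (hinv.and ((hev 124).and (hev (124 / δ))))))).mono ?_
  rintro q ⟨hgood, hconj, hq1, hqc, hq124, hqδ⟩
  obtain ⟨f, g, h, z, hf, hg, hh, h1, h2, h3⟩ := hconj hgood
  have hq1' : (1 : ℝ) ≤ q := by exact_mod_cast hq1
  have hq0 : (0 : ℝ) < q := by linarith
  have hL : 1 ≤ (q : ℝ) ^ k := one_le_pow₀ hq1'
  -- The grid size `N = q ^ (2 k + 1)` beats the loss `L ^ 2 = q ^ (2 k)` by one factor `q`.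
  have hscale : 31 * ((q : ℝ) ^ k) ^ 2 * (4 / ((q ^ (2 * k + 1) : ℕ) : ℝ)) = 124 / q := by
    push_cast
    field_simp
    ring
  have herr : 2 * (((q ^ b : ℕ) : ℝ) * (1 / (q : ℝ) ^ (b + (3 * k + 1)) * (1 + (q : ℝ) ^ k)))
      ≤ 4 / ((q ^ (2 * k + 1) : ℕ) : ℝ) := by
    push_cast
    calc 2 * ((q : ℝ) ^ b * (1 / (q : ℝ) ^ (b + (3 * k + 1)) * (1 + (q : ℝ) ^ k)))
        ≤ 2 * ((q : ℝ) ^ b * (1 / (q : ℝ) ^ (b + (3 * k + 1)) * (2 * (q : ℝ) ^ k))) := by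
          gcongr
          linarith
      _ = 4 / (q : ℝ) ^ (2 * k + 1) := by
          field_simp
          ring
  obtain ⟨x, hx⟩ := exists_shadowing hφ hη hψ hL hf hg hh h1 h2 h3 (n := q ^ b)
    (N := q ^ (2 * k + 1)) (by positivity) herr
    (by rw [hscale, div_le_one hq0]; exact hq124)
  rw [hscale] at hx
  have hcov : coverNum (skew α hφ hη hψ) d ρ (q ^ b) ε ≤ ((q ^ (2 * k + 1)) ^ 4 : ℕ) := by
    refine coverNum_le ρ hε x fun y => ?_
    obtain ⟨i, hi⟩ := hx y
    refine ⟨i, lt_of_le_of_lt (meanDist_le (by positivity) fun j hj => ?_) (half_lt_self hε)⟩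
    refine hclose _ _ ((hi j hj.le).mono ?_)
    rw [div_le_iff₀ hδ] at hqδ
    rw [div_le_iff₀ hq0]
    linarith
  refine le_trans ?_ ((natCast_pow_div_rpow_le hq1 hb.le).trans hqc)
  rw [← pow_mul] at hcov
  gcongr
  exact_mod_cast ENat.toENNReal_le.2 hcov

/-! ### Distances on the phase space -/

theorem pdist_le_of_close {mG : MetricSpace Heis}
    (hk : ∀ g h : Heis, mG.dist g h ≤ kap (g⁻¹ * h)) {δ : ℝ} {p q : Phase} (h : Close δ p q) :
    pdist mG.dist p q ≤ 2 * δ := by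
  obtain ⟨t, t', g, g', rfl, rfl, ht, hg⟩ := h
  have hnn : ∀ x y, 0 ≤ mG.dist x y := fun x y => @dist_nonneg _ mG.toPseudoMetricSpace x y
  have h1 : Nil.ndist mG.dist (Nil.mk g) (Nil.mk g') ≤ δ := by
    have hb : BddBelow {r : ℝ | ∃ x y : Heis, Nil.mk x = Nil.mk g ∧ Nil.mk y = Nil.mk g' ∧
        r = mG.dist x y} := ⟨0, ?_⟩
    · exact (csInf_le hb ⟨g, g', rfl, rfl, rfl⟩).trans ((hk g g').trans hg)
    rintro r ⟨x, y, _, _, rfl⟩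
    exact hnn x y
  have h2 : 0 ≤ Nil.ndist mG.dist (Nil.mk g) (Nil.mk g') := by
    refine Real.sInf_nonneg ?_
    rintro r ⟨x, y, _, _, rfl⟩
    exact hnn x y
  have h3 : ‖(t : UnitAddCircle) - (t' : UnitAddCircle)‖ ≤ δ := by
    rw [← AddCircle.coe_sub, UnitAddCircle.norm_eq]
    refine le_trans ?_ ht
    simpa using round_le (t - t') 0
  have h4 := norm_nonneg ((t : UnitAddCircle) - (t' : UnitAddCircle))
  refine Real.sqrt_le_iff.2 ⟨by linarith, ?_⟩
  change ‖(t : UnitAddCircle) - (t' : UnitAddCircle)‖ ^ 2 +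
    Nil.ndist mG.dist (Nil.mk g) (Nil.mk g') ^ 2 ≤ _
  nlinarith

theorem continuous_dist_of_induces {X : Type*} [t : TopologicalSpace X] {m : MetricSpace X}
    (h : Induces m) : Continuous fun p : X × X => m.dist p.1 p.2 := by
  unfold Induces at h
  subst h
  exact continuous_dist

theorem Phase.continuous_of : Continuous fun x : ℝ × ℝ × ℝ × ℝ =>
    Phase.of x.1 ⟨x.2.1, x.2.2.1, x.2.2.2⟩ := by
  have h1 : Continuous fun x : ℝ × ℝ × ℝ => (⟨x.1, x.2.1, x.2.2⟩ : Heis) :=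
    continuous_induced_rng.2 continuous_id
  have h2 : Continuous Nil.mk := continuous_quotient_mk'
  exact ((AddCircle.continuous_mk' 1).comp continuous_fst).prodMk
    ((h2.comp h1).comp continuous_snd)

theorem abs_le_of_kap_le {v : Heis} {δ : ℝ} (h : kap v ≤ δ) (hδ : δ ≤ 1) :
    |v.a| ≤ δ ∧ |v.b| ≤ δ ∧ |v.c| ≤ 2 * δ := by
  rw [kap, max_le_iff, max_le_iff] at h
  obtain ⟨hb, ha, hc⟩ := h
  refine ⟨ha, hb, ?_⟩
  have h1 := abs_add_le (v.c - v.a * v.b) (v.a * v.b)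
  rw [sub_add_cancel, abs_mul] at h1
  nlinarith [abs_nonneg v.a, abs_nonneg v.b]

/-- The distance between a point and its displacement by `s` is continuous in both and zero at `s =
0`, hence uniformly small over the compact unit cube. Lattice multiplication on the left moves any
lift into the cube without changing `g⁻¹ * g'`. -/
theorem exists_dist_le_of_close {m : MetricSpace Phase} (hm : Induces m) {ε : ℝ} (hε : 0 < ε) :
    ∃ δ : ℝ, 0 < δ ∧ ∀ p q, Close δ p q → m.dist p q ≤ ε := by
  let F : (ℝ × ℝ × ℝ × ℝ) × (ℝ × ℝ × ℝ × ℝ) → ℝ := fun z =>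
    m.dist (Phase.of z.2.1 ⟨z.2.2.1, z.2.2.2.1, z.2.2.2.2⟩)
      (Phase.of (z.2.1 + z.1.1)
        (⟨z.2.2.1, z.2.2.2.1, z.2.2.2.2⟩ * ⟨z.1.2.1, z.1.2.2.1, z.1.2.2.2⟩))
  have hF : Continuous F := by
    refine (continuous_dist_of_induces hm).comp
      ((Phase.continuous_of.comp continuous_snd).prodMk ?_)
    exact Phase.continuous_of.comp (f := fun z : (ℝ × ℝ × ℝ × ℝ) × (ℝ × ℝ × ℝ × ℝ) =>
      (z.2.1 + z.1.1, z.2.2.1 + z.1.2.1, z.2.2.2.1 + z.1.2.2.1,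
        z.2.2.2.2 + z.1.2.2.2 + z.2.2.1 * z.1.2.2.1)) (by fun_prop)
  have hF0 : ∀ x, F (0, x) = 0 := by
    intro x
    have h1 : (⟨x.2.1, x.2.2.1, x.2.2.2⟩ * ⟨0, 0, 0⟩ : Heis) = ⟨x.2.1, x.2.2.1, x.2.2.2⟩ :=
      mul_one _
    simp only [F, Prod.fst_zero, Prod.snd_zero, add_zero, h1]
    exact @dist_self _ m.toPseudoMetricSpace _
  have hK : IsCompact (Set.Icc (0 : ℝ) 1 ×ˢ Set.Icc (0 : ℝ) 1 ×ˢ Set.Icc (0 : ℝ) 1 ×ˢ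
      Set.Icc (0 : ℝ) 1) :=
    isCompact_Icc.prod (isCompact_Icc.prod (isCompact_Icc.prod isCompact_Icc))
  have hev := hK.eventually_forall_of_forall_eventually (x₀ := (0 : ℝ × ℝ × ℝ × ℝ))
    (P := fun s x => F (s, x) < ε) fun x _ =>
      hF.continuousAt.eventually_lt continuousAt_const (by rw [hF0]; exact hε)
  obtain ⟨r, hr, hball⟩ := Metric.eventually_nhds_iff.1 hev
  -- The bound 1 gives `|v.c| ≤ 2 δ`, and `r / 3` then keeps all coordinates strictly below `r`.
  refine ⟨min (r / 3) 1, by positivity, ?_⟩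
  rintro _ _ ⟨t, t', g, g', rfl, rfl, ht, hg⟩
  obtain ⟨γ, hγ, ha, hb, hc⟩ := exists_gam_mul_mem g
  obtain ⟨va, vb, vc⟩ := abs_le_of_kap_le hg (min_le_right _ _)
  have hmin : min (r / 3) 1 ≤ r / 3 := min_le_left _ _
  set v := g⁻¹ * g' with hv
  have hdist : dist ((t' - t, v.a, v.b, v.c) : ℝ × ℝ × ℝ × ℝ) 0 < r := by
    rw [dist_zero_right, Prod.norm_def, Prod.norm_def, Prod.norm_def]
    simp only [Real.norm_eq_abs, max_lt_iff]
    rw [abs_sub_comm] at ht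
    refine ⟨?_, ?_, ?_, ?_⟩ <;> linarith
  have h1 := hball hdist (Int.fract t, (γ * g).a, (γ * g).b, (γ * g).c)
    ⟨⟨Int.fract_nonneg _, (Int.fract_lt_one _).le⟩, Set.Ico_subset_Icc_self ha,
      Set.Ico_subset_Icc_self hb, Set.Ico_subset_Icc_self hc⟩
  have h2 : Phase.of (Int.fract t) (γ * g) = Phase.of t g := by
    rw [Phase.of_gam_mul hγ]
    exact Phase.of_sub_intCast ⌊t⌋ t g
  have h3 : Phase.of (Int.fract t + (t' - t)) (γ * g * v) = Phase.of t' g' := by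
    rw [hv, mul_assoc, Phase.of_gam_mul hγ, mul_inv_cancel_left, Int.fract,
      show t - ⌊t⌋ + (t' - t) = t' - ⌊t⌋ by ring, Phase.of_sub_intCast]
  rw [← h2, ← h3]
  exact h1.le

end Covering

end HeisSkew

end

theorem theorem1p3 (α : ℝ) (hα : Irrational α) (φ η ψ : ℝ → ℝ)
    (hφ : Function.Periodic φ 1) (hη : Function.Periodic η 1) (hψ : Function.Periodic ψ 1)
    (hφs : ContDiff ℝ ∞ φ) (hηs : ContDiff ℝ ∞ η) (hψs : ContDiff ℝ ∞ ψ)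
    (hφ0 : ∫ t in (0 : ℝ)..1, φ t = 0) (hη0 : ∫ t in (0 : ℝ)..1, η t = 0)
    (ρ : MeasureTheory.Measure HeisSkew.Phase) (hρ : MeasureTheory.IsProbabilityMeasure ρ)
    (hinv : MeasureTheory.MeasurePreserving (HeisSkew.skew α hφ hη hψ) ρ ρ) :
    -- for the metric that comes from a left invariant metric on the Heisenberg group
    (∀ mG : MetricSpace HeisSkew.Heis,
      (∀ k g h : HeisSkew.Heis, mG.dist (k * g) (k * h) = mG.dist g h) →
      (∀ g h : HeisSkew.Heis, mG.dist g h ≤ HeisSkew.kap (g⁻¹ * h)) →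
      HeisSkew.SubPolynomial (HeisSkew.skew α hφ hη hψ) (HeisSkew.pdist mG.dist) ρ) ∧
    -- and for every metric that induces the topology
    (∀ m : MetricSpace HeisSkew.Phase, HeisSkew.Induces m →
      HeisSkew.SubPolynomial (HeisSkew.skew α hφ hη hψ) m.dist ρ) := by
  refine ⟨fun mG _ hk => ?_, fun m hm => ?_⟩
  · refine HeisSkew.subPolynomial_of_close hα hφ hη hψ hφs hηs hψs hφ0 hη0 ρ fun ε hε => ?_
    exact ⟨ε / 2, half_pos hε, fun p q h =>
      (HeisSkew.pdist_le_of_close hk h).trans (by linarith)⟩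
  · exact HeisSkew.subPolynomial_of_close hα hφ hη hψ hφs hηs hψs hφ0 hη0 ρ fun ε hε =>
      HeisSkew.exists_dist_le_of_close hm hε
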